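/- Let $q$ be a prime power, $r\ge 1$ a divisor of $q-1$, $p$ a prime with $p\nmid q-1$, and $b\ge 1$ an integer. Put $m=p^b$, $n=\Phi_{m}(q)=\frac{q^{p^b}-1}{q^{p^{b-1}}-1}$ and $s=\frac{q^m-1}{nr}$. **Notation.** Let $Z_{n,r}=\{1+ir:0\le i\le n-1\}\subseteq\{1,\dots,nr\}$, where the residues modulo $nr$ are represented by $1,\dots,nr$. The $q$-cyclotomic coset of $i$ modulo $nr$ is $C_i=\{iq^j \bmod nr: j\ge 0\}$, its leader is its smallest element, and $N_l$ denotes the number of distinct cosets $C_i$ with $i\in Z_{n,r}$ and $|C_i|=l$. Let $T_{\lceil\rceil}$ (respectively $T_{\lfloor\rfloor}$) be the union, over all coset sizes $l$, of the first $\lceil N_l/2\rceil$ (respectively $\lfloor N_l/2\rfloor$) cosets of size $l$ in $Z_{n,r}$, ordered by their leaders. For $\lambda\in\mathbb F_q^*$ of multiplicative order $r$ and a primitive $nr$-th root of unity $\beta$ in $\overline{\mathbb F_q}$ with $\beta^n=\lambda$, the defining set with respect to $\beta$ of the $\lambda$-constacyclic code $\langle g(x)\rangle\subseteq \mathbb F_q[x]/\langle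 x^n-\lambda\rangle$, where $g\mid x^n-\lambda$ is monic, is $\{i\in Z_{n,r}: g(\beta^i)=0\}$. Let $S_m$ be the set of triples of integers $(i,j,t)$ with $$\frac{m+1}{2}\le i\le \lfloor m-\log_q(s+1)\rfloor,\quad 1\le j\le q-1,\quad 0\le t<\frac{q^i-j(q^{m-i}-1)-1}{q^{m-i+1}-q},$$ $$q^i+qt+j\equiv 1 \pmod r,\qquad q^i+qt+j\le 1+\left(\left\lceil \frac{q\lceil N_m/2\rceil}{q-1}\right\rceil-2\right)r,$$ and let $\Lambda_m=\left\lceil\frac{q|S_m|}{q-1}\right\rceil-1$. **Theorem.** The set of coset sizes $\{|C_i|:i\in Z_{n,r}\}$ equals $\{1,p^b\}$, and $N_1=1$, $N_{p^b}=(n-1)/p^b$. For fixed $q,p$ the length $n$ strictly increases with $b$, so that the following codes form infinite families. There are elements $\lambda\in\mathbb F_q^*$ of order $r$; for each of them there is a primitive $nr$-th root of unity $\beta\in\overline{\mathbb F_q}$ with $\beta^n=\lambda$, and for every such $\beta$ the following hold. 1. There is a $\lambda$-constacyclic code of length $n$ over $\mathbb F_q$ with defining set $T_{\lceil\rceil}$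 with respect to $\beta$; it has dimension $n-1-p^b\left\lceil\frac{n-1}{2p^b}\right\rceil$ and minimum distance at least $$\left\lceil\frac{q\lceil (n-1)/(2p^b)\rceil}{q-1}\right\rceil+\Lambda_{p^b}.$$ 2. If $r\le 3$ or $2p^b(q-1)\ge qr$, then there is a $\lambda$-constacyclic code of length $n$ over $\mathbb F_q$ with defining set $T_{\lfloor\rfloor}$ with respect to $\beta$; it has dimension $n-p^b\left\lfloor\frac{n-1}{2p^b}\right\rfloor$ and minimum distance at least $$\left\lfloor\frac{q(n-1)}{2p^b(q-1)}\right\rfloor.$$ (A lower bound on the minimum distance is regarded as vacuously true for the zero code.) -/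

import Mathlib

/-- The set `Z_{n,r} = {1 + i r : 0 ≤ i ≤ n - 1}`, a subset of `{1, …, n r}`. -/
def zSet (n r : ℕ) : Finset ℕ :=
  (Finset.range n).image (fun i => 1 + i * r)

open Classical in
/-- The `q`-cyclotomic coset of `i` modulo `N`, where the residues modulo `N` are represented
by `1, …, N` (so the class of zero is represented by `N`). -/
noncomputable def cycCoset (q N i : ℕ) : Finset ℕ :=
  (Finset.Icc 1 N).filter (fun x => ∃ j : ℕ, x ≡ i * q ^ j [MOD N])

/-- The set of all sizes of the `q`-cyclotomic cosets modulo `n r` of elements of `Z_{n,r}`. -/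
noncomputable def cosetSizes (q n r : ℕ) : Finset ℕ :=
  (zSet n r).image (fun i => (cycCoset q (n * r) i).card)

/-- The number `N_l` of `q`-cyclotomic cosets modulo `n r` of elements of `Z_{n,r}`
that have exactly `l` elements. -/
noncomputable def numCosets (q n r l : ℕ) : ℕ :=
  (((zSet n r).image (cycCoset q (n * r))).filter (fun c => c.card = l)).card

open Classical in
/-- The coset leaders (smallest elements) of the cosets with exactly `l` elements
in `Z_{n,r}`. -/
noncomputable def cosetLeaders (q n r l : ℕ) : Finset ℕ :=
  (zSet n r).filter (fun a => (cycCoset q (n * r) a).card = l ∧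
    ∀ x ∈ cycCoset q (n * r) a, a ≤ x)

/-- The first `k` coset leaders, in ascending order, of the cosets with exactly `l` elements
in `Z_{n,r}` (all of them if there are fewer than `k`). -/
noncomputable def firstLeaders (q n r l k : ℕ) : Finset ℕ :=
  (cosetLeaders q n r l).filter
    (fun a => ((cosetLeaders q n r l).filter (fun a' => a' < a)).card < k)

/-- The union, over all coset sizes `l`, of the first `h N_l` cosets with `l` elements
in `Z_{n,r}`, ordered by their leaders. -/
noncomputable def firstCosetsUnion (h : ℕ → ℕ) (q n r : ℕ) : Finset ℕ :=
  (cosetSizes q n r).biUnion (fun l =>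
    (firstLeaders q n r l (h (numCosets q n r l))).biUnion (cycCoset q (n * r)))

/-- The union of the first half, rounded up, of the cosets of each size. -/
noncomputable def ceilHalfSet (q n r : ℕ) : Finset ℕ :=
  firstCosetsUnion (fun N => ⌈(N : ℚ) / 2⌉₊) q n r

/-- The union of the first half, rounded down, of the cosets of each size. -/
noncomputable def floorHalfSet (q n r : ℕ) : Finset ℕ :=
  firstCosetsUnion (fun N => ⌊(N : ℚ) / 2⌋₊) q n r

/-- The set `S_m` of triples `(i, j, t)`, for `n r = (q ^ m - 1) / s`. Here `s` is the real number
`(q ^ m - 1) / (n r)`. As `s > 0`, the second condition forces `i < m`, so the subtractions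
in the exponents do not truncate and the denominator is positive. -/
noncomputable def tripleSet (q n r m : ℕ) : Set (ℕ × ℕ × ℕ) :=
  {x | match x with
    | (i, j, t) =>
      ((m : ℝ) + 1) / 2 ≤ (i : ℝ) ∧
      (i : ℤ) ≤ ⌊(m : ℝ) - Real.logb q (((q : ℝ) ^ m - 1) / ((n : ℝ) * r) + 1)⌋ ∧
      1 ≤ j ∧ j ≤ q - 1 ∧
      (t : ℝ) < ((q : ℝ) ^ i - (j : ℝ) * ((q : ℝ) ^ (m - i) - 1) - 1) /
        ((q : ℝ) ^ (m - i + 1) - q) ∧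
      q ^ i + q * t + j ≡ 1 [MOD r] ∧
      ((q ^ i + q * t + j : ℕ) : ℤ) ≤
        1 + (⌈(q : ℚ) * (⌈(numCosets q n r m : ℚ) / 2⌉ : ℚ) / ((q : ℚ) - 1)⌉ - 2) * (r : ℤ)}

/-- `Λ_m = ⌈q |S_m| / (q - 1)⌉ - 1`, an integer that may be `-1`. -/
noncomputable def bigLambda (q n r m : ℕ) : ℤ :=
  ⌈(q : ℚ) * ((tripleSet q n r m).ncard : ℚ) / ((q : ℚ) - 1)⌉ - 1

/-- The polynomial `c_0 + c_1 x + ⋯ + c_{n-1} x^{n-1}` of a word `c`, as a class in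
`F[x] / (x^n - lam)`. -/
noncomputable def wordClass {F : Type*} [Field F] (n : ℕ) (lam : F) :
    (Fin n → F) →ₗ[F] AdjoinRoot (Polynomial.X ^ n - Polynomial.C lam : Polynomial F) where
  toFun c := ∑ k : Fin n, c k • AdjoinRoot.root (Polynomial.X ^ n - Polynomial.C lam) ^ (k : ℕ)
  map_add' c d := by simp [add_smul, Finset.sum_add_distrib]
  map_smul' a c := by simp [mul_smul, Finset.smul_sum]

/-- The `lam`-constacyclic code `⟨g(x)⟩` of length `n`: the words whose polynomial lies in the
ideal of `F[x] / (x^n - lam)` generated by `g`. -/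
noncomputable def constacyclicCode {F : Type*} [Field F] (n : ℕ) (lam : F) (g : Polynomial F) :
    Submodule F (Fin n → F) :=
  ((Ideal.span {AdjoinRoot.mk (Polynomial.X ^ n - Polynomial.C lam) g}).restrictScalars F).comap
    (wordClass n lam)

/-- The code is closed under `(c_0, …, c_{n-1}) ↦ (lam c_{n-1}, c_0, …, c_{n-2})`. -/
def IsConstacyclic {F : Type*} [Field F] {n : ℕ} (lam : F)
    (code : Submodule F (Fin n → F)) : Prop :=
  ∀ c ∈ code, (fun k : Fin n => if (k : ℕ) = 0
    then lam * c ⟨n - 1, Nat.sub_one_lt_of_lt k.isLt⟩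
    else c ⟨(k : ℕ) - 1, lt_of_le_of_lt (Nat.sub_le _ _) k.isLt⟩) ∈ code

open Classical in
/-- The defining set, with respect to `β`, of the constacyclic code with generator
polynomial `g`. -/
noncomputable def definingSet {F K : Type*} [Field F] [Field K] [Algebra F K] (n r : ℕ) (β : K)
    (g : Polynomial F) : Finset ℕ :=
  (zSet n r).filter (fun i => Polynomial.aeval (β ^ i) g = 0)

/-- The minimum (Hamming) distance of the code is at least `d`; no condition for
the zero code. -/
def MinDistGE {F : Type*} [Field F] {n : ℕ} (code : Submodule F (Fin n → F)) (d : ℤ) : Prop :=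
  ∀ u ∈ code, ∀ v ∈ code, u ≠ v → d ≤ (({k : Fin n | u k ≠ v k} : Set (Fin n)).ncard : ℤ)

/-! Write Q = q^{m/p}, so that n = 1 + Q + ⋯ + Q^{p-1}. If q had order less than m modulo a prime l
∣ n, then Q ≡ 1 mod l, so n ≡ p mod l and l = p; Fermat then gives q ≡ Q ≡ 1 mod p, which is
excluded. Hence q^e - 1 is coprime to n for 0 < e < m, and the coset of x in Z_{n,r} has one element
if n ∣ x and m elements otherwise. As n and r are coprime, exactly one x in Z_{n,r} is a multiple of
n; this gives N_1 and N_m.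

A union T of cosets is stable under multiplication by q, so ∏_{x∈T} (X - β^x) is fixed by Frobenius
and descends to F (`exists_generator`). The code has dimension n - |T|.

The distance comes from the BCH bound: if T contains 1 + ir for all i < D, the distance is at least
D + 1. The leader of 1 + ir is at most 1 + ir, so for cosets of size m it suffices that at most as
many leaders lie below 1 + Dr as cosets were chosen (`mem_firstCosetsUnion_of_count`). A multiple of
q is never a leader, since x/q is in its coset; this leaves at most D - ⌊D/q⌋ candidates. For the
rounded-up code the triples in S_m yield |S_m| further nonleaders, which raise D by about
q|S_m|/(q-1).

The coset of size 1 is always chosen when rounding up and never when rounding down. In the second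
case the condition on r keeps 1 + ir below n for i < D, so that coset is not met. -/

/-- `Φ_{p^b}(q)` as a geometric sum. -/
theorem cyclotomic_prime_pow_eval (p b q : ℕ) (hp : p.Prime) :
    (Polynomial.cyclotomic (p ^ (b + 1)) ℤ).eval (q : ℤ) =
      ((∑ i ∈ Finset.range p, (q ^ p ^ b) ^ i : ℕ) : ℤ) := by
  rw [Polynomial.cyclotomic_prime_pow_eq_geom_sum hp]
  simp [Polynomial.eval_finsetSum]

theorem geom_sum_modEq_of_modEq_one {Q k : ℕ} (p : ℕ) (h : Q ≡ 1 [MOD k]) :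
    ∑ i ∈ Finset.range p, Q ^ i ≡ p [MOD k] := by
  induction p with
  | zero => rfl
  | succ p ih =>
    rw [Finset.sum_range_succ]
    simpa using ih.add (h.pow p)

/-- If `p ∤ q - 1`, then the multiplicative order of `q` modulo every prime divisor of
`Φ_{p^(b+1)}(q)` is `p^(b+1)`. -/
theorem coprime_pow_sub_one_geom_sum {q p b e : ℕ} (hq : 2 ≤ q) (hp : p.Prime)
    (hpq : ¬ p ∣ q - 1) (he : 0 < e) (hlt : e < p ^ (b + 1)) :
    (q ^ e - 1).Coprime (∑ i ∈ Finset.range p, (q ^ p ^ b) ^ i) := by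
  have hQ : 1 ≤ q ^ p ^ b := Nat.one_le_pow _ _ (by omega)
  refine Nat.coprime_of_dvd fun l hl hle hln => ?_
  have hlm : l ∣ q ^ p ^ (b + 1) - 1 := by
    have := geom_sum_mul_of_one_le hQ p
    rw [← pow_mul, ← pow_succ] at this
    rw [← this]
    exact hln.mul_right _
  have hgcd := Nat.dvd_gcd hle hlm
  -- l divides q^{gcd(e,m)} - 1, and gcd(e,m) is a proper divisor of p^(b+1), hence divides p^b.
  rw [Nat.pow_sub_one_gcd_pow_sub_one] at hgcd
  obtain ⟨c, hc, hce⟩ := (Nat.dvd_prime_pow hp).1 (Nat.gcd_dvd_right e (p ^ (b + 1)))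
  have hcb : c ≤ b := by
    by_contra hcb
    have : c = b + 1 := by omega
    subst this
    exact absurd (Nat.le_of_dvd he (hce ▸ Nat.gcd_dvd_left e (p ^ (b + 1)))) (by omega)
  rw [hce] at hgcd
  have hlQ : l ∣ q ^ p ^ b - 1 := by
    refine hgcd.trans ?_
    obtain ⟨d, rfl⟩ := Nat.exists_eq_add_of_le hcb
    rw [pow_add, pow_mul]
    exact Nat.sub_one_dvd_pow_sub_one _ _
  have hQ1 : q ^ p ^ b ≡ 1 [MOD l] := ((Nat.modEq_iff_dvd' hQ).2 hlQ).symm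
  have hlp : l ∣ p := (Nat.modEq_zero_iff_dvd).1
    ((geom_sum_modEq_of_modEq_one p hQ1).symm.trans ((Nat.modEq_zero_iff_dvd).2 hln))
  obtain rfl : l = p := (Nat.prime_dvd_prime_iff_eq hl hp).1 hlp
  have := Fact.mk hp
  -- In `ZMod l`, with l = p, raising to the power p^b is the identity.
  have h1 : q ≡ 1 [MOD l] := by
    rw [← ZMod.natCast_eq_natCast_iff] at hQ1 ⊢
    rwa [Nat.cast_pow, ZMod.pow_card_pow] at hQ1
  exact hpq ((Nat.modEq_iff_dvd' (by omega)).1 h1.symm)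

/-- The arithmetic of `q`, `n`, `r`, `m` that determines the cosets in `Z_{n,r}`: the order of `q`
modulo every prime divisor of `n` is `m`. -/
structure CosetParams (q n r m : ℕ) : Prop where
  two_le : 2 ≤ q
  one_lt_n : 1 < n
  one_lt_m : 1 < m
  dvd : r ∣ q - 1
  pow_modEq : q ^ m ≡ 1 [MOD n * r]
  coprime_pow : ∀ e, 0 < e → e < m → (q ^ e - 1).Coprime n

theorem cosetParams_geom_sum {q p b r : ℕ} (hq : 2 ≤ q) (hp : p.Prime)
    (hpq : ¬ p ∣ q - 1) (hr : r ∣ q - 1) :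
    CosetParams q (∑ i ∈ Finset.range p, (q ^ p ^ b) ^ i) r (p ^ (b + 1)) where
  two_le := hq
  one_lt_n := by
    calc 1 < ∑ i ∈ Finset.range 2, (q ^ p ^ b) ^ i := by
          have : 0 < q ^ p ^ b := pow_pos (by omega) _
          simp [Finset.sum_range_succ]; omega
      _ ≤ _ := Finset.sum_le_sum_of_subset (Finset.range_mono hp.two_le)
  one_lt_m := Nat.one_lt_pow (by omega) hp.one_lt
  dvd := hr
  pow_modEq := by
    have hQ : 1 ≤ q ^ p ^ b := Nat.one_le_pow _ _ (by omega)
    refine ((Nat.modEq_iff_dvd' (Nat.one_le_pow _ _ (by omega))).2 ?_).symm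
    -- q^m - 1 = n(Q - 1) with Q = q^(p^b), and r ∣ q - 1 ∣ Q - 1.
    rw [pow_succ p, pow_mul, ← geom_sum_mul_of_one_le hQ p]
    exact mul_dvd_mul_left _ (hr.trans (Nat.sub_one_dvd_pow_sub_one _ _))
  coprime_pow _ he hlt := coprime_pow_sub_one_geom_sum hq hp hpq he hlt

/-! ### Residues represented by 1, …, N -/

section Residues

theorem exists_modEq_mem_Icc {N : ℕ} (hN : 0 < N) (y : ℕ) :
    ∃ x, (1 ≤ x ∧ x ≤ N) ∧ x ≡ y [MOD N] := by
  by_cases h : y % N = 0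
  · exact ⟨N, ⟨hN, le_rfl⟩, by simp [Nat.ModEq, h]⟩
  · exact ⟨y % N, ⟨Nat.pos_of_ne_zero h, (Nat.mod_lt _ hN).le⟩, Nat.mod_modEq _ _⟩

theorem eq_of_modEq_of_mem_Icc {N x y : ℕ} (hx : 1 ≤ x ∧ x ≤ N) (hy : 1 ≤ y ∧ y ≤ N)
    (h : x ≡ y [MOD N]) : x = y := by
  obtain ⟨x, rfl⟩ := Nat.exists_eq_add_of_le' hx.1
  obtain ⟨y, rfl⟩ := Nat.exists_eq_add_of_le' hy.1
  have := (Nat.ModEq.add_right_cancel' 1 h).eq_of_lt_of_lt (by omega) (by omega)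
  omega

theorem mem_zSet {n r x : ℕ} (hr : 0 < r) :
    x ∈ zSet n r ↔ (1 ≤ x ∧ x ≤ n * r) ∧ x ≡ 1 [MOD r] := by
  simp only [zSet, Finset.mem_image, Finset.mem_range]
  constructor
  · rintro ⟨i, hi, rfl⟩
    refine ⟨⟨by omega, ?_⟩, by simp [Nat.ModEq]⟩
    nlinarith
  · rintro ⟨⟨h1, h2⟩, h3⟩
    obtain ⟨i, hi⟩ := (Nat.modEq_iff_dvd' h1).1 h3.symm
    refine ⟨i, ?_, by rw [mul_comm]; omega⟩
    by_contra! h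
    have : r * n ≤ r * i := Nat.mul_le_mul_left _ h
    rw [mul_comm] at this
    omega

theorem card_zSet {n r : ℕ} (hr : 0 < r) : (zSet n r).card = n := by
  rw [zSet, Finset.card_image_of_injective, Finset.card_range]
  intro i j h
  have : i * r = j * r := by simpa using h
  exact Nat.eq_of_mul_eq_mul_right hr this

theorem mem_cycCoset {q N i x : ℕ} :
    x ∈ cycCoset q N i ↔ (1 ≤ x ∧ x ≤ N) ∧ ∃ j : ℕ, x ≡ i * q ^ j [MOD N] := by
  simp [cycCoset]

theorem self_mem_cycCoset {q N i : ℕ} (h : 1 ≤ i ∧ i ≤ N) : i ∈ cycCoset q N i :=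
  mem_cycCoset.2 ⟨h, 0, by simp; rfl⟩

end Residues

/-- In a finite set of numbers, `k` elements (or all) have fewer than `k` smaller ones. -/
theorem card_filter_card_lt (S : Finset ℕ) (k : ℕ) :
    (S.filter (fun a => (S.filter (fun a' => a' < a)).card < k)).card = min k S.card := by
  -- A new maximum leaves the ranks of the other elements unchanged, and its own rank is the old
  -- cardinality.
  refine Finset.induction_on_max S (by simp) fun a S hS ih => ?_
  have ha : a ∉ S := fun h => lt_irrefl _ (hS a h)
  have h1 : (insert a S).filter (fun a' => a' < a) = S := by
    rw [Finset.filter_insert, if_neg (lt_irrefl _), Finset.filter_true_of_mem hS]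
  have h2 : S.filter (fun x => ((insert a S).filter (fun a' => a' < x)).card < k) =
      S.filter (fun x => (S.filter (fun a' => a' < x)).card < k) := by
    refine Finset.filter_congr fun x hx => ?_
    rw [Finset.filter_insert, if_neg (not_lt.2 (hS x hx).le)]
  rw [Finset.filter_insert, h1, h2, Finset.card_insert_of_notMem ha]
  split_ifs with h
  · rw [Finset.card_insert_of_notMem (by simp [ha]), ih]
    omega
  · rw [ih]
    omega

/-! ### Sizes and numbers of cosets, leaders, and unions of cosets -/

namespace CosetParams

variable {q n r m : ℕ} (P : CosetParams q n r m)
include P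

theorem r_pos : 0 < r :=
  Nat.pos_of_dvd_of_pos P.dvd (by have := P.two_le; omega)

theorem N_pos : 0 < n * r := Nat.mul_pos (by have := P.one_lt_n; omega) P.r_pos

theorem q_modEq : q ≡ 1 [MOD r] :=
  ((Nat.modEq_iff_dvd' (by have := P.two_le; omega)).2 P.dvd).symm

theorem coprime_n_r : n.Coprime r := by
  have := P.coprime_pow 1 one_pos P.one_lt_m
  rw [pow_one] at this
  exact (Nat.Coprime.coprime_dvd_left P.dvd this).symm

theorem coprime_q : (n * r).Coprime q := by
  have h := P.pow_modEq.gcd_eq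
  rw [Nat.gcd_one_left] at h
  exact (Nat.Coprime.coprime_dvd_left (dvd_pow_self q (by have := P.one_lt_m; omega)) h).symm

theorem mem_zSet_of_modEq {x y : ℕ} (hx : x ∈ zSet n r) (hy : 1 ≤ y ∧ y ≤ n * r) {j : ℕ}
    (h : y ≡ x * q ^ j [MOD n * r]) : y ∈ zSet n r := by
  rw [mem_zSet P.r_pos] at hx ⊢
  refine ⟨hy, (h.of_mul_left n).trans ?_⟩
  simpa using hx.2.mul (P.q_modEq.pow j)

theorem cycCoset_subset {x : ℕ} (hx : x ∈ zSet n r) : cycCoset q (n * r) x ⊆ zSet n r := by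
  intro y hy
  obtain ⟨hy, j, hj⟩ := mem_cycCoset.1 hy
  exact P.mem_zSet_of_modEq hx hy hj

theorem self_mem {x : ℕ} (hx : x ∈ zSet n r) : x ∈ cycCoset q (n * r) x :=
  self_mem_cycCoset ((mem_zSet P.r_pos).1 hx).1

theorem cycCoset_eq {x y : ℕ} (hy : y ∈ cycCoset q (n * r) x) :
    cycCoset q (n * r) y = cycCoset q (n * r) x := by
  obtain ⟨-, j, hj⟩ := mem_cycCoset.1 hy
  ext z
  simp only [mem_cycCoset]
  refine and_congr_right fun _ => ⟨?_, ?_⟩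
  · rintro ⟨k, hk⟩
    refine ⟨j + k, hk.trans ?_⟩
    rw [pow_add, ← mul_assoc]
    exact hj.mul_right _
  · rintro ⟨k, hk⟩
    have hm : j ≤ m * j := Nat.le_mul_of_pos_left _ (by have := P.one_lt_m; omega)
    -- q^(mj-j) is an inverse of q^j because q^m ≡ 1.
    refine ⟨m * j - j + k, hk.trans ?_⟩
    calc x * q ^ k ≡ x * q ^ k * (q ^ m) ^ j [MOD n * r] := by
          simpa using ((P.pow_modEq.pow j).symm.mul_left (x * q ^ k))
      _ = x * q ^ j * q ^ (m * j - j + k) := by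
          rw [← pow_mul, mul_assoc, mul_assoc, ← pow_add, ← pow_add]
          congr 2; omega
      _ ≡ y * q ^ (m * j - j + k) [MOD n * r] := hj.symm.mul_right _

theorem cycCoset_eq_iff {x y : ℕ} (hy : y ∈ zSet n r) :
    cycCoset q (n * r) y = cycCoset q (n * r) x ↔ y ∈ cycCoset q (n * r) x :=
  ⟨fun h => h ▸ P.self_mem hy, P.cycCoset_eq⟩

/-- Multiplication by `q` fixes the multiples of `n` in `Z_{n,r}`. -/
theorem card_cycCoset_of_dvd {x : ℕ} (hx : x ∈ zSet n r) (hn : n ∣ x) :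
    (cycCoset q (n * r) x).card = 1 := by
  rw [Finset.card_eq_one]
  refine ⟨x, Finset.eq_singleton_iff_unique_mem.2 ⟨P.self_mem hx, fun y hy => ?_⟩⟩
  obtain ⟨hy, j, hj⟩ := mem_cycCoset.1 hy
  refine eq_of_modEq_of_mem_Icc hy ((mem_zSet P.r_pos).1 hx).1 (hj.trans ?_)
  obtain ⟨c, rfl⟩ := hn
  rw [mul_assoc]
  refine Nat.ModEq.mul_left' n ?_
  simpa using (P.q_modEq.pow j).mul_left c

/-- A coincidence among the xq^j with j < m would give n ∣ x(q^e - 1) with 0 < e < m, hence n ∣ x by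
coprimality. -/
theorem card_cycCoset_of_not_dvd {x : ℕ} (hn : ¬ n ∣ x) :
    (cycCoset q (n * r) x).card = m := by
  choose f hf using fun j => exists_modEq_mem_Icc P.N_pos (x * q ^ j)
  have himg : cycCoset q (n * r) x = (Finset.range m).image f := by
    ext y
    simp only [mem_cycCoset, Finset.mem_image, Finset.mem_range]
    constructor
    · rintro ⟨hy, j, hj⟩
      refine ⟨j % m, Nat.mod_lt _ (by have := P.one_lt_m; omega),
        eq_of_modEq_of_mem_Icc (hf _).1 hy ((hf _).2.trans (Nat.ModEq.trans ?_ hj.symm))⟩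
      refine Nat.ModEq.mul_left x ?_
      conv_rhs => rw [← Nat.mod_add_div j m, pow_add, pow_mul]
      simpa using ((P.pow_modEq.pow (j / m)).symm.mul_left (q ^ (j % m)))
    · rintro ⟨j, -, rfl⟩
      exact ⟨(hf j).1, j, (hf j).2⟩
  have key : ∀ i j, i < j → j < m → f i ≠ f j := by
    intro i j hij hj h
    have h1 : x * q ^ i ≡ x * q ^ j [MOD n * r] := (hf i).2.symm.trans (h ▸ (hf j).2)
    have h2 := h1.of_mul_right r
    obtain ⟨e, rfl⟩ := Nat.exists_eq_add_of_le hij.le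
    have hc : n.Coprime (q ^ i) :=
      Nat.Coprime.pow_right _ (Nat.Coprime.coprime_dvd_left (dvd_mul_right n r) P.coprime_q)
    have h3 : x * 1 ≡ x * q ^ e [MOD n] := by
      refine Nat.ModEq.cancel_left_of_coprime hc (c := q ^ i) ?_
      rw [pow_add] at h2
      convert h2 using 1 <;> ring
    have h4 : n ∣ x * q ^ e - x * 1 := (Nat.modEq_iff_dvd'
      (Nat.mul_le_mul_left _ (Nat.one_le_pow _ _ (by have := P.two_le; omega)))).1 h3
    rw [← Nat.mul_sub] at h4
    exact hn ((P.coprime_pow e (by omega) (by omega)).symm.dvd_of_dvd_mul_right h4)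
  rw [himg, Finset.card_image_of_injOn, Finset.card_range]
  intro i hi j hj h
  rcases lt_trichotomy i j with hij | hij | hij
  · exact absurd h (key i j hij (by simpa using hj))
  · exact hij
  · exact absurd h.symm (key j i hij (by simpa using hi))

/-- Chinese remainder theorem: x ≡ 0 mod n and x ≡ 1 mod r. -/
theorem existsUnique_dvd : ∃ x ∈ zSet n r, n ∣ x ∧ ∀ y ∈ zSet n r, n ∣ y → y = x := by
  obtain ⟨k, hk0, hk1⟩ := Nat.chineseRemainder P.coprime_n_r 0 1
  obtain ⟨x, hx, hxk⟩ := exists_modEq_mem_Icc P.N_pos k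
  have hxn := (hxk.of_mul_right r).trans hk0
  have hxr := (hxk.of_mul_left n).trans hk1
  refine ⟨x, (mem_zSet P.r_pos).2 ⟨hx, hxr⟩, (Nat.modEq_zero_iff_dvd).1 hxn, fun y hy hny => ?_⟩
  obtain ⟨hy, hy1⟩ := (mem_zSet P.r_pos).1 hy
  refine eq_of_modEq_of_mem_Icc hy hx ?_
  exact (Nat.modEq_and_modEq_iff_modEq_mul P.coprime_n_r).1
    ⟨((Nat.modEq_zero_iff_dvd).2 hny).trans hxn.symm, hy1.trans hxr.symm⟩

theorem card_cycCoset {x : ℕ} (hx : x ∈ zSet n r) :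
    (cycCoset q (n * r) x).card = if n ∣ x then 1 else m := by
  split_ifs with h
  · exact P.card_cycCoset_of_dvd hx h
  · exact P.card_cycCoset_of_not_dvd h

theorem card_filter_dvd : ((zSet n r).filter (fun x => n ∣ x)).card = 1 := by
  obtain ⟨x, hx, hnx, huniq⟩ := P.existsUnique_dvd
  rw [Finset.card_eq_one]
  refine ⟨x, ?_⟩
  ext y
  simp only [Finset.mem_filter, Finset.mem_singleton]
  exact ⟨fun h => huniq y h.1 h.2, fun h => h ▸ ⟨hx, hnx⟩⟩

theorem card_filter_not_dvd : ((zSet n r).filter (fun x => ¬ n ∣ x)).card = n - 1 := by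
  have := Finset.card_filter_add_card_filter_not (s := zSet n r) (fun x => n ∣ x)
  rw [P.card_filter_dvd, card_zSet P.r_pos] at this
  omega

theorem cosetSizes_eq : cosetSizes q n r = {1, m} := by
  obtain ⟨x, hx, hnx, -⟩ := P.existsUnique_dvd
  have hpos : 0 < ((zSet n r).filter (fun x => ¬ n ∣ x)).card := by
    rw [P.card_filter_not_dvd]; have := P.one_lt_n; omega
  obtain ⟨y, hy⟩ := Finset.card_pos.1 hpos
  obtain ⟨hy, hny⟩ := Finset.mem_filter.1 hy
  ext l
  simp only [cosetSizes, Finset.mem_image, Finset.mem_insert, Finset.mem_singleton]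
  constructor
  · rintro ⟨z, hz, rfl⟩
    rw [P.card_cycCoset hz]
    split_ifs <;> simp
  · rintro (rfl | rfl)
    · exact ⟨x, hx, P.card_cycCoset_of_dvd hx hnx⟩
    · exact ⟨y, hy, P.card_cycCoset_of_not_dvd hny⟩

/-- Count elements along the map x ↦ C_x: its fibre over a coset is that coset. -/
theorem numCosets_mul (l : ℕ) :
    numCosets q n r l * l =
      ((zSet n r).filter (fun x => (cycCoset q (n * r) x).card = l)).card := by
  set Z := (zSet n r).filter (fun x => (cycCoset q (n * r) x).card = l) with hZ
  have himg : ((zSet n r).image (cycCoset q (n * r))).filter (fun c => c.card = l) =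
      Z.image (cycCoset q (n * r)) := by
    rw [Finset.filter_image]
  rw [numCosets, himg, Finset.card_eq_sum_card_image (cycCoset q (n * r)) Z,
    Finset.sum_const_nat (m := l)]
  intro c hc
  obtain ⟨x, hx, rfl⟩ := Finset.mem_image.1 hc
  obtain ⟨hxz, hxl⟩ := Finset.mem_filter.1 hx
  rw [← hxl]
  congr 1
  ext y
  simp only [hZ, Finset.mem_filter]
  constructor
  · rintro ⟨⟨hy, -⟩, h⟩
    exact (P.cycCoset_eq_iff hy).1 h
  · intro hy
    have := P.cycCoset_eq hy
    exact ⟨⟨P.cycCoset_subset hxz hy, by rw [this, hxl]⟩, this⟩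

theorem numCosets_one : numCosets q n r 1 = 1 := by
  rw [← mul_one (numCosets q n r 1), P.numCosets_mul]
  refine Eq.trans (congrArg Finset.card ?_) P.card_filter_dvd
  refine Finset.filter_congr fun x hx => ?_
  rw [P.card_cycCoset hx]
  have := P.one_lt_m
  split_ifs with h <;> simp [h]
  omega

theorem numCosets_m_mul : numCosets q n r m * m = n - 1 := by
  rw [P.numCosets_mul, ← P.card_filter_not_dvd]
  congr 1
  refine Finset.filter_congr fun x hx => ?_
  rw [P.card_cycCoset hx]
  have := P.one_lt_m
  split_ifs with h <;> simp [h]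
  omega

theorem exists_leader {x : ℕ} (hx : x ∈ zSet n r) :
    ∃ a ∈ cosetLeaders q n r (cycCoset q (n * r) x).card, a ≤ x ∧ x ∈ cycCoset q (n * r) a ∧
      cycCoset q (n * r) a = cycCoset q (n * r) x := by
  have hne : (cycCoset q (n * r) x).Nonempty := ⟨x, P.self_mem hx⟩
  have ha := Finset.min'_mem _ hne
  set a := (cycCoset q (n * r) x).min' hne
  have hc := P.cycCoset_eq ha
  refine ⟨a, ?_, Finset.min'_le _ _ (P.self_mem hx), hc ▸ P.self_mem hx, hc⟩
  rw [cosetLeaders, Finset.mem_filter, hc]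
  exact ⟨P.cycCoset_subset hx ha, rfl, fun y hy => Finset.min'_le _ _ hy⟩

theorem leader_injOn (l l' : ℕ) {a a' : ℕ} (ha : a ∈ cosetLeaders q n r l)
    (ha' : a' ∈ cosetLeaders q n r l') (h : cycCoset q (n * r) a = cycCoset q (n * r) a') :
    a = a' := by
  obtain ⟨hz, -, hmin⟩ := Finset.mem_filter.1 ha
  obtain ⟨hz', -, hmin'⟩ := Finset.mem_filter.1 ha'
  exact le_antisymm (hmin _ (h ▸ P.self_mem hz')) (hmin' _ (h ▸ P.self_mem hz))

theorem card_cosetLeaders (l : ℕ) : (cosetLeaders q n r l).card = numCosets q n r l := by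
  rw [numCosets, ← Finset.card_image_of_injOn (f := cycCoset q (n * r))
    (fun a ha a' ha' h => P.leader_injOn l l ha ha' h)]
  congr 1
  ext c
  simp only [Finset.mem_image, Finset.mem_filter]
  constructor
  · rintro ⟨a, ha, rfl⟩
    obtain ⟨hz, hl, -⟩ := Finset.mem_filter.1 ha
    exact ⟨⟨a, hz, rfl⟩, hl⟩
  · rintro ⟨⟨x, hx, rfl⟩, rfl⟩
    obtain ⟨a, ha, -, -, hc⟩ := P.exists_leader hx
    exact ⟨a, ha, hc⟩

theorem card_firstLeaders (l k : ℕ) :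
    (firstLeaders q n r l k).card = min k (numCosets q n r l) := by
  rw [firstLeaders, card_filter_card_lt, P.card_cosetLeaders]

omit P in
theorem mem_firstCosetsUnion {h : ℕ → ℕ} {x : ℕ} :
    x ∈ firstCosetsUnion h q n r ↔ ∃ l ∈ cosetSizes q n r,
      ∃ a ∈ firstLeaders q n r l (h (numCosets q n r l)), x ∈ cycCoset q (n * r) a := by
  simp [firstCosetsUnion]

omit P in
theorem mem_leaders_of_mem_first {l k a : ℕ} (ha : a ∈ firstLeaders q n r l k) :
    a ∈ cosetLeaders q n r l := (Finset.mem_filter.1 ha).1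

theorem firstCosetsUnion_subset (h : ℕ → ℕ) : firstCosetsUnion h q n r ⊆ zSet n r := by
  intro x hx
  obtain ⟨l, -, a, ha, hxa⟩ := mem_firstCosetsUnion.1 hx
  exact P.cycCoset_subset (Finset.mem_filter.1 (mem_leaders_of_mem_first ha)).1 hxa

theorem firstCosetsUnion_mul {h : ℕ → ℕ} {x y : ℕ} (hx : x ∈ firstCosetsUnion h q n r)
    (hy : 1 ≤ y ∧ y ≤ n * r) (hxy : y ≡ x * q [MOD n * r]) :
    y ∈ firstCosetsUnion h q n r := by
  obtain ⟨l, hl, a, ha, hxa⟩ := mem_firstCosetsUnion.1 hx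
  refine mem_firstCosetsUnion.2 ⟨l, hl, a, ha, ?_⟩
  rw [← P.cycCoset_eq hxa]
  exact mem_cycCoset.2 ⟨hy, 1, by simpa using hxy⟩

theorem card_firstCosetsUnion (h : ℕ → ℕ) (hh : ∀ N, h N ≤ N) :
    (firstCosetsUnion h q n r).card = h 1 + m * h (numCosets q n r m) := by
  have hdisj : ∀ (l l' a a' : ℕ), a ∈ cosetLeaders q n r l → a' ∈ cosetLeaders q n r l' →
      a ≠ a' → Disjoint (cycCoset q (n * r) a) (cycCoset q (n * r) a') := by
    intro l l' a a' ha ha' hne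
    rw [Finset.disjoint_left]
    intro x hx hx'
    exact hne (P.leader_injOn l l' ha ha' ((P.cycCoset_eq hx).symm.trans (P.cycCoset_eq hx')))
  have hsize : ∀ l, ((firstLeaders q n r l (h (numCosets q n r l))).biUnion
      (cycCoset q (n * r))).card = h (numCosets q n r l) * l := by
    intro l
    rw [Finset.card_biUnion, Finset.sum_const_nat (m := l), P.card_firstLeaders,
      min_eq_left (hh _)]
    · intro a ha
      exact (Finset.mem_filter.1 (mem_leaders_of_mem_first ha)).2.1
    · intro a ha a' ha' hne
      exact hdisj l l a a' (mem_leaders_of_mem_first ha) (mem_leaders_of_mem_first ha') hne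
  have h1m : (1 : ℕ) ≠ m := P.one_lt_m.ne
  rw [firstCosetsUnion, P.cosetSizes_eq, Finset.card_biUnion, Finset.sum_pair h1m, hsize, hsize,
    P.numCosets_one]
  · ring
  · intro l _ l' _ hne
    rw [Function.onFun, Finset.disjoint_biUnion_left]
    intro a ha
    rw [Finset.disjoint_biUnion_right]
    intro a' ha'
    have hm := mem_leaders_of_mem_first ha
    have hm' := mem_leaders_of_mem_first ha'
    refine hdisj l l' a a' hm hm' ?_
    rintro rfl
    exact hne ((Finset.mem_filter.1 hm).2.1.symm.trans (Finset.mem_filter.1 hm').2.1)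

end CosetParams

/-! ### Constacyclic codes: dimension, BCH bound, generator from a defining set -/

open Polynomial

section Code

variable {F : Type*} [Field F]

/-- The polynomial `c_0 + c_1 x + ⋯ + c_{n-1} x^{n-1}` of a word. -/
noncomputable def wordPoly (n : ℕ) : (Fin n → F) →ₗ[F] F[X] :=
  (degreeLT F n).subtype ∘ₗ (degreeLTEquiv F n).symm.toLinearMap

theorem wordPoly_apply {n : ℕ} (c : Fin n → F) :
    wordPoly n c = ∑ k : Fin n, C (c k) * X ^ (k : ℕ) := by
  simp [wordPoly, degreeLTEquiv, C_mul_X_pow_eq_monomial]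

theorem coeff_wordPoly {n : ℕ} (c : Fin n → F) (k : Fin n) : (wordPoly n c).coeff k = c k :=
  congrFun ((degreeLTEquiv F n).apply_symm_apply c) k

theorem wordPoly_injective {n : ℕ} : Function.Injective (wordPoly (F := F) n) := by
  intro c d h
  ext k
  rw [← coeff_wordPoly c, h, coeff_wordPoly]

theorem wordPoly_coeff_of_degree_lt {n : ℕ} {f : F[X]} (hf : f.degree < n) :
    wordPoly n (fun k : Fin n => f.coeff k) = f :=
  congrArg Subtype.val ((degreeLTEquiv F n).symm_apply_apply ⟨f, mem_degreeLT.2 hf⟩)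

theorem degree_wordPoly_lt {n : ℕ} (c : Fin n → F) : (wordPoly n c).degree < n :=
  mem_degreeLT.1 ((degreeLTEquiv F n).symm c).2

theorem wordClass_eq_mk {n : ℕ} {lam : F} (c : Fin n → F) :
    wordClass n lam c = AdjoinRoot.mk (X ^ n - C lam) (wordPoly n c) := by
  rw [wordPoly_apply, map_sum]
  simp only [map_mul, map_pow, AdjoinRoot.mk_X, AdjoinRoot.mk_C, wordClass, LinearMap.coe_mk,
    AddHom.coe_mk, Algebra.smul_def]
  rfl

theorem mem_constacyclicCode {n : ℕ} {lam : F} {g : F[X]} (hg : g ∣ X ^ n - C lam)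
    {c : Fin n → F} : c ∈ constacyclicCode n lam g ↔ g ∣ wordPoly n c := by
  simp only [constacyclicCode, Submodule.mem_comap, Submodule.restrictScalars_mem,
    Ideal.mem_span_singleton, wordClass_eq_mk]
  constructor
  · rintro ⟨a, ha⟩
    obtain ⟨a, rfl⟩ := AdjoinRoot.mk_surjective a
    rw [← map_mul, AdjoinRoot.mk_eq_mk] at ha
    have := dvd_add (hg.trans ha) (dvd_mul_right g a)
    simpa using this
  · exact fun h => map_dvd _ h

theorem isConstacyclic_constacyclicCode {n : ℕ} {lam : F} {g : F[X]} (hg : g ∣ X ^ n - C lam) :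
    IsConstacyclic lam (constacyclicCode n lam g) := by
  intro c hc
  rw [mem_constacyclicCode hg] at hc ⊢
  rcases n with _ | n
  · convert hc
  -- The shift is multiplication by X, with the top term reduced modulo X^(n+1) - lam.
  have : wordPoly (n + 1) (fun k : Fin (n + 1) => if (k : ℕ) = 0
      then lam * c ⟨n + 1 - 1, Nat.sub_one_lt_of_lt k.isLt⟩
      else c ⟨(k : ℕ) - 1, lt_of_le_of_lt (Nat.sub_le _ _) k.isLt⟩) =
      wordPoly (n + 1) c * X - C (c (Fin.last n)) * (X ^ (n + 1) - C lam) := by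
    rw [wordPoly_apply, wordPoly_apply, Fin.sum_univ_succ, Fin.sum_univ_castSucc, add_mul,
      Finset.sum_mul]
    simp only [Fin.val_succ, Fin.val_zero, if_true, Nat.succ_ne_zero, if_false, pow_zero, mul_one,
      Nat.add_sub_cancel, Fin.val_castSucc, Fin.val_last, pow_succ]
    have h : ∀ i : Fin n, (⟨(i : ℕ), by omega⟩ : Fin (n + 1)) = i.castSucc := fun i => rfl
    have h' : (⟨n, by omega⟩ : Fin (n + 1)) = Fin.last n := rfl
    simp only [h, h', map_mul, mul_assoc]
    ring
  rw [this]
  exact dvd_sub (hc.mul_right _) (hg.mul_left _)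

/-- Multiplication by g maps the polynomials of degree below n - deg g isomorphically onto the code.
-/
theorem finrank_constacyclicCode {n : ℕ} {lam : F} {g : F[X]} (hn : 0 < n) (hmon : g.Monic)
    (hg : g ∣ X ^ n - C lam) :
    Module.finrank F (constacyclicCode n lam g) = n - g.natDegree := by
  have hd : g.natDegree ≤ n := by
    have := natDegree_le_of_dvd hg (X_pow_sub_C_ne_zero hn lam)
    rwa [natDegree_X_pow_sub_C] at this
  let φ : (Fin (n - g.natDegree) → F) →ₗ[F] (Fin n → F) :=
    { toFun := fun a k => (g * wordPoly _ a).coeff k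
      map_add' := fun a b => by ext k; simp [mul_add]
      map_smul' := fun s a => by ext k; simp }
  have hφ : ∀ a, wordPoly n (φ a) = g * wordPoly _ a := by
    intro a
    refine wordPoly_coeff_of_degree_lt (f := g * wordPoly _ a) ?_
    rw [degree_mul, degree_eq_natDegree hmon.ne_zero]
    calc (g.natDegree : WithBot ℕ) + (wordPoly _ a).degree
        < (g.natDegree : WithBot ℕ) + ((n - g.natDegree : ℕ) : WithBot ℕ) :=
          WithBot.add_lt_add_left (by simp) (degree_wordPoly_lt a)
      _ = n := by rw [← Nat.cast_add, Nat.add_sub_cancel' hd]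
  have hinj : Function.Injective φ := by
    intro a b h
    have := congrArg (wordPoly n) h
    rw [hφ, hφ] at this
    exact wordPoly_injective (mul_left_cancel₀ hmon.ne_zero this)
  have hrange : LinearMap.range φ = constacyclicCode n lam g := by
    ext c
    rw [mem_constacyclicCode hg, LinearMap.mem_range]
    constructor
    · rintro ⟨a, rfl⟩
      rw [hφ]
      exact dvd_mul_right _ _
    · rintro ⟨f, hf⟩
      have hfd : f.degree < (n - g.natDegree : ℕ) := by
        by_cases hf0 : f = 0
        · rw [hf0, degree_zero]; exact WithBot.bot_lt_coe _
        have := degree_wordPoly_lt c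
        rw [hf, degree_lt_iff_coeff_zero] at this
        rw [degree_eq_natDegree hf0, Nat.cast_lt]
        by_contra! hle
        refine hf0 (leadingCoeff_eq_zero.1 ?_)
        have h0 := this (g.natDegree + f.natDegree) (by omega)
        rwa [coeff_mul_degree_add_degree, hmon.leadingCoeff, one_mul] at h0
      refine ⟨fun k => f.coeff k, wordPoly_injective ?_⟩
      rw [hφ, wordPoly_coeff_of_degree_lt hfd, hf]
  rw [← hrange, LinearMap.finrank_range_of_inj hinj, Module.finrank_fin_fun]

variable {K : Type*} [Field K] [Algebra F K]

/-- BCH bound: a nonzero word vanishing at `β^(1+ir)` for `i < D` has more than `D`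
nonzero entries. -/
theorem bch_bound {n r D : ℕ} (hr : 0 < r) {β : K} (hβ : IsPrimitiveRoot β (n * r))
    {c : Fin n → F} (hc : c ≠ 0)
    (hz : ∀ i < D, i < n → aeval (β ^ (1 + i * r)) (wordPoly n c) = 0) :
    D < ({k : Fin n | c k ≠ 0} : Set (Fin n)).ncard := by
  classical
  by_contra! hle
  set S : Finset (Fin n) := Finset.univ.filter (fun k => c k ≠ 0) with hS
  have hcard : ({k : Fin n | c k ≠ 0} : Set (Fin n)).ncard = S.card := by
    rw [← Set.ncard_coe_finset]; simp [hS]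
  rw [hcard] at hle
  obtain ⟨k₀, hk₀⟩ : ∃ k, c k ≠ 0 := by
    by_contra! h
    exact hc (funext h)
  have hk₀S : k₀ ∈ S := by simp [hS, hk₀]
  have hn : 0 < n := k₀.pos
  have hβ0 : β ≠ 0 := hβ.ne_zero (Nat.mul_pos hn hr).ne'
  have hprim : IsPrimitiveRoot (β ^ r) n :=
    hβ.pow (Nat.mul_pos hn hr) (mul_comm n r)
  -- The zeros at β^(1+ir) are the relations for P = X^i; those with i < |S| ≤ n suffice, so D may
  -- exceed n.
  have hlin : ∀ P : K[X], P.natDegree < S.card →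
      ∑ k : Fin n, algebraMap F K (c k) * β ^ (k : ℕ) * P.eval ((β ^ r) ^ (k : ℕ)) = 0 := by
    intro P hP
    have hSn : S.card ≤ n := by simpa using Finset.card_le_univ S
    simp only [eval_eq_sum_range, Finset.mul_sum]
    rw [Finset.sum_comm]
    refine Finset.sum_eq_zero fun i hi => ?_
    have hi : i < S.card := by
      have := Finset.mem_range.1 hi
      omega
    have h := hz i (by omega) (by omega)
    rw [wordPoly_apply, map_sum] at h
    simp only [map_mul, aeval_C, map_pow, aeval_X] at h
    rw [← mul_zero (P.coeff i), ← h, Finset.mul_sum]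
    refine Finset.sum_congr rfl fun k _ => ?_
    ring
  -- This P kills every term of the relation except the one at k₀, replacing a Vandermonde
  -- determinant.
  set P : K[X] := ∏ k ∈ S.erase k₀, (X - C ((β ^ r) ^ (k : ℕ))) with hP
  have hdeg : P.natDegree < S.card := by
    rw [hP, natDegree_prod_of_monic _ _ fun k _ => monic_X_sub_C _]
    simp only [natDegree_X_sub_C, Finset.sum_const, smul_eq_mul, mul_one]
    exact Finset.card_erase_lt_of_mem hk₀S
  have h := hlin P hdeg
  rw [Finset.sum_eq_single k₀] at h
  · have hPk : P.eval ((β ^ r) ^ (k₀ : ℕ)) ≠ 0 := by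
      rw [hP, eval_prod, Finset.prod_ne_zero_iff]
      intro k hk
      rw [eval_sub, eval_X, eval_C, sub_ne_zero]
      intro heq
      exact (Finset.mem_erase.1 hk).1 (Fin.ext (hprim.pow_inj k₀.2 k.2 heq)).symm
    have hc0 : algebraMap F K (c k₀) ≠ 0 := by simpa using hk₀
    exact mul_ne_zero (mul_ne_zero hc0 (pow_ne_zero _ hβ0)) hPk h
  · intro k _ hk
    by_cases hkS : k ∈ S
    · have : P.eval ((β ^ r) ^ (k : ℕ)) = 0 := by
        rw [hP, eval_prod]
        exact Finset.prod_eq_zero (Finset.mem_erase.2 ⟨hk, hkS⟩) (by simp)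
      rw [this, mul_zero]
    · have : c k = 0 := by simpa [hS] using hkS
      rw [this, map_zero, zero_mul, zero_mul]
  · simp

/-- The BCH bound for a constacyclic code whose defining set contains `1 + ir` for `i < D`. -/
theorem minDistGE_of_definingSet {n r D : ℕ} (hr : 0 < r) {lam : F} {g : F[X]}
    (hg : g ∣ X ^ n - C lam) {β : K} (hβ : IsPrimitiveRoot β (n * r))
    (hz : ∀ i < D, i < n → 1 + i * r ∈ definingSet n r β g) {d : ℤ} (hd : d ≤ D + 1) :
    MinDistGE (constacyclicCode n lam g) d := by
  intro u hu v hv huv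
  have hmem := sub_mem hu hv
  rw [mem_constacyclicCode hg] at hmem
  have := bch_bound (D := D) hr hβ (sub_ne_zero.2 huv) fun i hi hin => by
    have h := hz i hi hin
    simp only [definingSet, Finset.mem_filter] at h
    exact aeval_eq_zero_of_dvd_aeval_eq_zero hmem h.2
  simp only [Pi.sub_apply, sub_ne_zero] at this
  omega

variable [Fintype F]

/-- The image of F already supplies as many roots of X^|F| - X as its degree allows. -/
theorem mem_range_algebraMap_of_pow_card_eq {x : K} (hx : x ^ Fintype.card F = x) :
    x ∈ (algebraMap F K).range := by
  classical
  have hne := FiniteField.X_pow_card_sub_X_ne_zero K (Fintype.one_lt_card (α := F))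
  have hsub : (Finset.univ.image (algebraMap F K)) ⊆
      (X ^ Fintype.card F - X : K[X]).roots.toFinset := by
    intro y hy
    obtain ⟨a, -, rfl⟩ := Finset.mem_image.1 hy
    rw [Multiset.mem_toFinset, mem_roots hne, IsRoot.def]
    simp [← map_pow, FiniteField.pow_card]
  have heq := Finset.eq_of_subset_of_card_le hsub (by
    rw [Finset.card_image_of_injective _ (algebraMap F K).injective, Finset.card_univ]
    refine (Multiset.toFinset_card_le _).trans ((card_roots' _).trans ?_)
    rw [FiniteField.X_pow_card_sub_X_natDegree_eq K (Fintype.one_lt_card (α := F))])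
  have : x ∈ (X ^ Fintype.card F - X : K[X]).roots.toFinset := by
    rw [Multiset.mem_toFinset, mem_roots hne, IsRoot.def]
    simp [hx]
  rw [← heq] at this
  obtain ⟨a, -, rfl⟩ := Finset.mem_image.1 this
  exact ⟨a, rfl⟩

/-- A set of exponents stable under multiplication by `q` is the defining set of a constacyclic
code over the field with `q` elements. -/
theorem exists_generator {q n r m : ℕ} (P : CosetParams q n r m) (hq : Fintype.card F = q)
    {lam : F} (hlam : orderOf lam = r) {β : K} (hβ : IsPrimitiveRoot β (n * r))
    (hβn : β ^ n = algebraMap F K lam) {T : Finset ℕ} (hT : T ⊆ zSet n r)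
    (hTq : ∀ x ∈ T, ∀ y, 1 ≤ y ∧ y ≤ n * r → y ≡ x * q [MOD n * r] → y ∈ T) :
    ∃ g : F[X], g.Monic ∧ g ∣ X ^ n - C lam ∧ definingSet n r β g = T ∧
      g.natDegree = T.card := by
  classical
  have hinj : ∀ x ∈ zSet n r, ∀ y ∈ zSet n r, β ^ x = β ^ y → x = y := by
    intro x hx y hy h
    refine eq_of_modEq_of_mem_Icc ((mem_zSet P.r_pos).1 hx).1 ((mem_zSet P.r_pos).1 hy).1 ?_
    rw [hβ.eq_orderOf]
    exact hβ.isUnit P.N_pos.ne' |>.elim fun u hu => by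
      rw [← hu, orderOf_units, ← pow_eq_pow_iff_modEq]
      ext; push_cast; rw [hu, h]
  have hmod : ∀ {x y : ℕ}, x ≡ y [MOD n * r] → β ^ x = β ^ y := by
    intro x y h
    rw [← pow_mod_orderOf, ← hβ.eq_orderOf, h, hβ.eq_orderOf, pow_mod_orderOf]
  set G : K[X] := ∏ x ∈ T, (X - C (β ^ x)) with hG
  have hmon : G.Monic := monic_prod_of_monic _ _ fun x _ => monic_X_sub_C _
  -- the Frobenius permutes the factors
  choose! f hf using fun x => exists_modEq_mem_Icc P.N_pos (x * q)
  have hfT : ∀ x ∈ T, f x ∈ T := fun x hx => hTq x hx _ (hf x).1 (hf x).2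
  have hfinj : Set.InjOn f T := by
    intro x hx y hy h
    have h1 : q * x ≡ q * y [MOD n * r] := by
      have := (hf x).2.symm.trans (h ▸ (hf y).2)
      rwa [mul_comm x, mul_comm y] at this
    exact eq_of_modEq_of_mem_Icc ((mem_zSet P.r_pos).1 (hT hx)).1 ((mem_zSet P.r_pos).1 (hT hy)).1
      (Nat.ModEq.cancel_left_of_coprime P.coprime_q h1)
  have himg : T.image f = T :=
    Finset.eq_of_subset_of_card_le (Finset.image_subset_iff.2 hfT)
      (Finset.card_image_of_injOn hfinj).ge
  let φ : K →+* K := (FiniteField.frobeniusAlgHom F K : K →ₐ[F] K)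
  have hφ : ∀ x, φ x = x ^ q := fun x => by
    subst hq; rfl
  have hfrob : G.map φ = G := by
    rw [hG, Polynomial.map_prod]
    conv_rhs => rw [← himg, Finset.prod_image hfinj]
    refine Finset.prod_congr rfl fun x _ => ?_
    rw [Polynomial.map_sub, map_X, map_C, hφ, ← pow_mul, hmod (hf x).2]
  have hlift : G ∈ lifts (algebraMap F K) := by
    rw [lifts_iff_coeff_lifts]
    intro k
    refine mem_range_algebraMap_of_pow_card_eq (F := F) ?_
    rw [hq, ← hφ, ← coeff_map, hfrob]
  obtain ⟨g, hgG, hgdeg, hgmon⟩ := lifts_and_natDegree_eq_and_monic hlift hmon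
  refine ⟨g, hgmon, ?_, ?_, ?_⟩
  · rw [← map_dvd_map' (algebraMap F K), hgG]
    refine Finset.prod_dvd_of_coprime ?_ fun x hx => ?_
    · intro x hx y hy hxy
      refine isCoprime_X_sub_C_of_isUnit_sub (IsUnit.mk0 _ (sub_ne_zero.2 fun h => hxy ?_))
      exact hinj x (hT hx) y (hT hy) h
    · rw [dvd_iff_isRoot, IsRoot.def]
      -- x ≡ 1 modulo the order r of lam, so (β^x)^n = lam^x = lam.
      have hx1 := ((mem_zSet P.r_pos).1 (hT hx)).2
      have : lam ^ x = lam := by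
        rw [← pow_mod_orderOf, hlam, hx1, ← hlam, pow_mod_orderOf, pow_one]
      simp only [Polynomial.map_sub, Polynomial.map_pow, map_X, map_C, eval_sub, eval_pow, eval_X,
        eval_C]
      rw [← pow_mul, mul_comm, pow_mul, hβn, ← map_pow, this, sub_self]
  · ext x
    simp only [definingSet, Finset.mem_filter]
    have hroot : aeval (β ^ x) g = 0 ↔ ∃ y ∈ T, β ^ x = β ^ y := by
      rw [← eval_map_algebraMap, hgG, hG, eval_prod, Finset.prod_eq_zero_iff]
      simp [sub_eq_zero]
    rw [hroot]
    constructor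
    · rintro ⟨hx, y, hy, h⟩
      rwa [hinj x hx y (hT hy) h]
    · exact fun hx => ⟨hT hx, x, hx, rfl⟩
  · rw [hgdeg, hG, natDegree_prod_of_monic _ _ fun k _ => monic_X_sub_C _]
    simp only [natDegree_X_sub_C, Finset.sum_const, smul_eq_mul, mul_one]

theorem exists_orderOf_eq {q r : ℕ} (hq : Fintype.card F = q) (hr : r ∣ q - 1) (hq2 : 2 ≤ q) :
    ∃ lam : F, orderOf lam = r := by
  classical
  obtain ⟨u, hu⟩ := IsCyclic.exists_ofOrder_eq_natCard (α := Fˣ)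
  rw [Nat.card_eq_fintype_card, Fintype.card_units, hq] at hu
  obtain ⟨s, hs⟩ := hr
  have hs0 : s ≠ 0 := by rintro rfl; omega
  refine ⟨((u ^ s : Fˣ) : F), ?_⟩
  rw [orderOf_units, orderOf_pow_of_dvd hs0 (by rw [hu, hs]; exact dvd_mul_left _ _), hu, hs,
    Nat.mul_div_cancel _ (Nat.pos_of_ne_zero hs0)]

/-- Take β = γμ^u with γ a primitive n-th root of unity, μ the image of lam, and u inverse to n mod
r. Each of μ and μ^u is a power of the other, so both have order r, which is coprime to n. -/
theorem exists_primitiveRoot_pow_eq [IsAlgClosed K] {q n r m : ℕ} (P : CosetParams q n r m)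
    (hq : Fintype.card F = q) {lam : F} (hlam : orderOf lam = r) :
    ∃ β : K, IsPrimitiveRoot β (n * r) ∧ β ^ n = algebraMap F K lam := by
  have hn0 : (n : K) ≠ 0 := by
    intro h
    have hc : n.Coprime q := Nat.Coprime.coprime_dvd_left (dvd_mul_right n r) P.coprime_q
    have hq0 : (q : K) = 0 := by
      have : ((Fintype.card F : F)) = 0 := FiniteField.cast_card_eq_zero F
      rw [hq] at this
      simpa using congrArg (algebraMap F K) this
    have hb := (Nat.isCoprime_iff_coprime.2 hc)
    obtain ⟨a, b, hab⟩ := hb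
    have := congrArg (Int.cast : ℤ → K) hab
    push_cast at this
    rw [h, hq0] at this
    simp at this
  have : NeZero (n : K) := ⟨hn0⟩
  obtain ⟨γ, hγ⟩ := HasEnoughRootsOfUnity.exists_primitiveRoot K n
  obtain ⟨u, hu⟩ : ∃ u, n * u ≡ 1 [MOD r] := by
    obtain ⟨k, hk0, hk1⟩ := Nat.chineseRemainder P.coprime_n_r 0 1
    obtain ⟨u, rfl⟩ := (Nat.modEq_zero_iff_dvd).1 hk0
    exact ⟨u, hk1⟩
  set μ : K := algebraMap F K lam
  have hμ : orderOf μ = r := by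
    rw [← hlam]; exact orderOf_injective (algebraMap F K : F →* K) (algebraMap F K).injective lam
  have hμu : (μ ^ u) ^ n = μ := by
    rw [← pow_mul, mul_comm, ← pow_mod_orderOf, hμ, hu, ← hμ, pow_mod_orderOf, pow_one]
  have hμu' : orderOf (μ ^ u) = r := by
    refine Nat.dvd_antisymm (hμ ▸ orderOf_pow_dvd u) ?_
    conv_lhs => rw [← hμ, ← hμu]
    exact orderOf_pow_dvd n
  refine ⟨γ * μ ^ u, ?_, by rw [mul_pow, hγ.pow_eq_one, one_mul, hμu]⟩
  have := (Commute.all γ (μ ^ u)).orderOf_mul_eq_mul_orderOf_of_coprime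
    (by rw [← hγ.eq_orderOf, hμu']; exact P.coprime_n_r)
  rw [← hγ.eq_orderOf, hμu'] at this
  rw [← this]
  exact IsPrimitiveRoot.orderOf _

end Code

/-! ### Rounding -/

/-- q(D - ⌊D/q⌋) exceeds (q-1)D only by the remainder of D mod q, which is less than q. -/
theorem sub_div_le_of_mul_pred_le {q D W : ℕ} (hq : 0 < q) (h : D * (q - 1) ≤ q * W) :
    D - D / q ≤ W := by
  obtain ⟨q, rfl⟩ := Nat.exists_eq_add_of_le' hq
  have hd := Nat.mod_lt D hq
  have hD := Nat.div_add_mod D (q + 1)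
  set c := D / (q + 1)
  set d := D % (q + 1)
  simp only [Nat.add_sub_cancel] at h
  have h1 : (q + 1) * (q * c + d) < (q + 1) * (W + 1) := by
    rw [← hD] at h
    nlinarith
  have h2 := Nat.lt_of_mul_lt_mul_left h1
  have h3 : (q + 1) * c = q * c + c := by ring
  omega

theorem ratCeil_half (N : ℕ) : ⌈(N : ℚ) / 2⌉ = (((N + 1) / 2 : ℕ) : ℤ) := by
  rw [Int.ceil_eq_iff]
  have h1 : N + 1 < 2 * ((N + 1) / 2) + 2 := by omega
  have h2 : 2 * ((N + 1) / 2) ≤ N + 1 := by omega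
  have h3 : N ≤ 2 * ((N + 1) / 2) := by omega
  have h1' : (N : ℚ) + 1 < 2 * ((N + 1) / 2 : ℕ) + 2 := by exact_mod_cast h1
  have h2' : 2 * (((N + 1) / 2 : ℕ) : ℚ) ≤ N + 1 := by exact_mod_cast h2
  have h3' : (N : ℚ) ≤ 2 * ((N + 1) / 2 : ℕ) := by exact_mod_cast h3
  rw [Int.cast_natCast]
  constructor <;> linarith

theorem ratNatCeil_half (N : ℕ) : ⌈(N : ℚ) / 2⌉₊ = (N + 1) / 2 := by
  have h : ((⌈(N : ℚ) / 2⌉₊ : ℕ) : ℤ) = ⌈(N : ℚ) / 2⌉ := Int.natCast_ceil_eq_ceil (by positivity)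
  rw [ratCeil_half] at h
  exact_mod_cast h

theorem ratNatFloor_half (N : ℕ) : ⌊(N : ℚ) / 2⌋₊ = N / 2 := by
  have := Nat.floor_div_eq_div (K := ℚ) N 2
  simpa using this

theorem ratFloor_half (N : ℕ) : ⌊(N : ℚ) / 2⌋ = ((N / 2 : ℕ) : ℤ) := by
  rw [← ratNatFloor_half]
  exact (Int.natCast_floor_eq_floor (by positivity)).symm

/-! ### Counting leaders below a bound -/

namespace CosetParams

variable {q n r m : ℕ} (P : CosetParams q n r m)
include P

theorem notMem_cosetLeaders {l x y j : ℕ} (hy : 1 ≤ y) (hyx : y < x)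
    (h : y ≡ x * q ^ j [MOD n * r]) : x ∉ cosetLeaders q n r l := by
  intro hx
  obtain ⟨hz, -, hmin⟩ := Finset.mem_filter.1 hx
  have hxN := ((mem_zSet P.r_pos).1 hz).1.2
  have := hmin y (mem_cycCoset.2 ⟨⟨hy, by omega⟩, j, h⟩)
  omega

theorem not_dvd_of_mem_cosetLeaders {l x : ℕ} (hx : x ∈ cosetLeaders q n r l) : ¬ q ∣ x := by
  rintro ⟨y, rfl⟩
  have hx0 := ((mem_zSet P.r_pos).1 (Finset.mem_filter.1 hx).1).1.1
  have hy : 1 ≤ y := Nat.pos_of_ne_zero (by rintro rfl; simp at hx0)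
  have h2 := P.two_le
  refine P.notMem_cosetLeaders (j := m - 1) hy (by nlinarith) ?_ hx
  have hm : q ^ m = q * q ^ (m - 1) := by
    rw [← pow_succ']; congr 1; have := P.one_lt_m; omega
  calc y ≡ y * q ^ m [MOD n * r] := by simpa using P.pow_modEq.symm.mul_left y
    _ = q * y * q ^ (m - 1) := by rw [hm]; ring

theorem card_not_dvd_le (D : ℕ) :
    ((Finset.range D).filter (fun i => ¬ q ∣ 1 + i * r)).card ≤ D - D / q := by
  have hq : 0 < q := by have := P.two_le; omega
  have h := Finset.card_filter_add_card_filter_not (s := Finset.range D) (fun i => q ∣ 1 + i * r)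
  rw [Finset.card_range] at h
  have hcount := Nat.count_modEq_card D hq ((q - 1) / r)
  rw [Nat.count_eq_card_filter_range] at hcount
  -- i = (q-1)/r gives 1 + ir = q, so its class mod q yields multiples of q.
  have hsub : ((Finset.range D).filter (fun i => i ≡ (q - 1) / r [MOD q])) ⊆
      (Finset.range D).filter (fun i => q ∣ 1 + i * r) := by
    refine Finset.monotone_filter_right _ fun i _ hi => ?_
    rw [← Nat.modEq_zero_iff_dvd]
    refine ((hi.mul_right r).add_left 1).trans ?_
    rw [Nat.div_mul_cancel P.dvd, Nat.add_sub_cancel' (by omega)]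
    simp [Nat.ModEq]
  have := Finset.card_le_card hsub
  omega

/-- Elements of `Z_{n,r}` below `1 + Dr` that are multiples of `q`, or lie in a set `B` of further
nonleaders, are not leaders. -/
theorem card_leaders_add_card_le {D l : ℕ} (B : Finset ℕ)
    (hB : ∀ x ∈ B, x < 1 + D * r ∧ 1 ≤ x ∧ x ≡ 1 [MOD r] ∧ ¬ q ∣ x ∧ x ∉ cosetLeaders q n r l) :
    ((cosetLeaders q n r l).filter (fun a => a < 1 + D * r)).card + B.card ≤ D - D / q := by
  refine le_trans ?_ (P.card_not_dvd_le D)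
  have hdisj : Disjoint ((cosetLeaders q n r l).filter (fun a => a < 1 + D * r)) B := by
    rw [Finset.disjoint_left]
    exact fun x hx hxB => (hB x hxB).2.2.2.2 (Finset.mem_filter.1 hx).1
  rw [← Finset.card_union_of_disjoint hdisj]
  refine le_trans (Finset.card_le_card ?_) (Finset.card_image_le (f := fun i => 1 + i * r))
  intro x hx
  have h : x < 1 + D * r ∧ 1 ≤ x ∧ x ≡ 1 [MOD r] ∧ ¬ q ∣ x := by
    rcases Finset.mem_union.1 hx with hx | hx
    · obtain ⟨hx, hlt⟩ := Finset.mem_filter.1 hx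
      have hz := (mem_zSet P.r_pos).1 (Finset.mem_filter.1 hx).1
      exact ⟨hlt, hz.1.1, hz.2, P.not_dvd_of_mem_cosetLeaders hx⟩
    · obtain ⟨h1, h2, h3, h4, -⟩ := hB x hx
      exact ⟨h1, h2, h3, h4⟩
  obtain ⟨hlt, h1, hmod, hq⟩ := h
  obtain ⟨i, hi⟩ := (Nat.modEq_iff_dvd' h1).1 hmod.symm
  have hx : x = 1 + i * r := by rw [mul_comm]; omega
  subst hx
  refine Finset.mem_image.2 ⟨i, Finset.mem_filter.2 ⟨Finset.mem_range.2 ?_, hq⟩, rfl⟩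
  exact Nat.lt_of_mul_lt_mul_right (by omega : i * r < D * r)

theorem mem_firstCosetsUnion_of_count {h : ℕ → ℕ} {D : ℕ} (B : Finset ℕ)
    (hB : ∀ x ∈ B, x < 1 + D * r ∧ 1 ≤ x ∧ x ≡ 1 [MOD r] ∧ ¬ q ∣ x ∧ x ∉ cosetLeaders q n r m)
    (hD : D - D / q ≤ h (numCosets q n r m) + B.card)
    {i : ℕ} (hiD : i < D) (hin : i < n) (h1 : n ∣ 1 + i * r → 1 ≤ h 1) :
    1 + i * r ∈ firstCosetsUnion h q n r := by
  have hz : 1 + i * r ∈ zSet n r := Finset.mem_image.2 ⟨i, Finset.mem_range.2 hin, rfl⟩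
  obtain ⟨a, ha, hax, hxa, -⟩ := P.exists_leader hz
  rw [mem_firstCosetsUnion]
  rw [P.card_cycCoset hz] at ha
  split_ifs at ha with hn
  · refine ⟨1, by simp [P.cosetSizes_eq], a, Finset.mem_filter.2 ⟨ha, ?_⟩, hxa⟩
    rw [P.numCosets_one]
    refine lt_of_lt_of_le ?_ (h1 hn)
    have hlt := Finset.card_lt_card
      (Finset.filter_ssubset.2 ⟨a, ha, lt_irrefl a⟩ :
        (cosetLeaders q n r 1).filter (fun a' => a' < a) ⊂ cosetLeaders q n r 1)
    rwa [P.card_cosetLeaders, P.numCosets_one] at hlt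
  · refine ⟨m, by simp [P.cosetSizes_eq], a, Finset.mem_filter.2 ⟨ha, ?_⟩, hxa⟩
    have hle := P.card_leaders_add_card_le (l := m) B hB
    -- The leader a ≤ 1 + ir is itself counted below 1 + Dr, so its rank is strictly smaller than
    -- that count.
    have hirD : i * r < D * r := Nat.mul_lt_mul_of_pos_right hiD P.r_pos
    have hlt : ((cosetLeaders q n r m).filter (fun a' => a' < a)).card <
        ((cosetLeaders q n r m).filter (fun a => a < 1 + D * r)).card := by
      refine Finset.card_lt_card (Finset.ssubset_iff_of_subset ?_ |>.2 ⟨a, ?_, ?_⟩)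
      · exact Finset.monotone_filter_right _ fun x _ hx => by omega
      · exact Finset.mem_filter.2 ⟨ha, by omega⟩
      · simp
    omega

/-- The range of i enters through 1 ≤ i < m, and the bound on t is cleared of its denominator
q(q^(m-i) - 1). -/
theorem tripleSet_spec {i j t : ℕ} (h : (i, j, t) ∈ tripleSet q n r m) :
    1 ≤ i ∧ i < m ∧ 1 ≤ j ∧ j < q ∧ (q * t + j) * (q ^ (m - i) - 1) + 1 < q ^ i ∧
      q ^ i + q * t + j ≡ 1 [MOD r] ∧
      ((q ^ i + q * t + j : ℕ) : ℤ) ≤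
        1 + (⌈(q : ℚ) * (⌈(numCosets q n r m : ℚ) / 2⌉ : ℚ) / ((q : ℚ) - 1)⌉ - 2) * (r : ℤ) := by
  obtain ⟨h1, h2, h3, h4, h5, h6, h7⟩ := h
  have hq := P.two_le
  have hq1 : (1 : ℝ) < q := by exact_mod_cast hq
  have hi : 1 ≤ i := by
    by_contra! hi
    obtain rfl : i = 0 := by omega
    push_cast at h1
    have : (0 : ℝ) ≤ m := Nat.cast_nonneg m
    linarith
  have him : i < m := by
    have hpos : (0 : ℝ) < ((q : ℝ) ^ m - 1) / ((n : ℝ) * r) := by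
      refine div_pos (sub_pos.2 (one_lt_pow₀ hq1 (by have := P.one_lt_m; omega))) ?_
      exact_mod_cast P.N_pos
    have hlog := Real.logb_pos hq1 (show 1 < ((q : ℝ) ^ m - 1) / ((n : ℝ) * r) + 1 by linarith)
    have h2' := Int.le_floor.1 h2
    push_cast at h2'
    exact_mod_cast (show (i : ℝ) < m by linarith)
  refine ⟨hi, him, h3, by omega, ?_, h6, h7⟩
  have hqp : (1 : ℝ) < (q : ℝ) ^ (m - i) := one_lt_pow₀ hq1 (by omega)
  have hden : (0 : ℝ) < (q : ℝ) ^ (m - i + 1) - q := by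
    rw [pow_succ]; nlinarith
  rw [lt_div_iff₀ hden, pow_succ] at h5
  have hcast : ((q ^ (m - i) - 1 : ℕ) : ℝ) = (q : ℝ) ^ (m - i) - 1 := by
    rw [Nat.cast_sub (Nat.one_le_pow _ _ (by omega))]; simp
  have : (((q * t + j) * (q ^ (m - i) - 1) + 1 : ℕ) : ℝ) < ((q ^ i : ℕ) : ℝ) := by
    push_cast [hcast]
    linarith
  exact_mod_cast this

theorem tripleSet_lt {i j t : ℕ} (h : (i, j, t) ∈ tripleSet q n r m) : q * t + j < q ^ i := by
  obtain ⟨-, him, -, -, h5, -⟩ := P.tripleSet_spec h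
  have : 1 ≤ q ^ (m - i) - 1 := by
    have := Nat.one_lt_pow (n := m - i) (by omega) (by have := P.two_le; omega : 1 < q)
    omega
  have := Nat.le_mul_of_pos_right (q * t + j) this
  omega

/-- Multiplying by q^(m-i) turns q^i into q^m ≡ 1, and the bound on t says exactly that the result
is smaller. -/
theorem tripleSet_notMem_leaders {i j t l : ℕ} (h : (i, j, t) ∈ tripleSet q n r m) :
    q ^ i + q * t + j ∉ cosetLeaders q n r l := by
  obtain ⟨-, him, -, -, h5, -⟩ := P.tripleSet_spec h
  have hpow : 1 ≤ q ^ (m - i) := Nat.one_le_pow _ _ (by have := P.two_le; omega)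
  refine P.notMem_cosetLeaders (y := 1 + (q * t + j) * q ^ (m - i)) (j := m - i) (by omega) ?_ ?_
  · obtain ⟨c, hc⟩ := Nat.exists_eq_add_of_le' hpow
    rw [hc, Nat.add_sub_cancel] at h5
    rw [hc]
    linarith
  · have hm : q ^ m = q ^ i * q ^ (m - i) := by rw [← pow_add]; congr 1; omega
    calc 1 + (q * t + j) * q ^ (m - i)
        ≡ q ^ m + (q * t + j) * q ^ (m - i) [MOD n * r] := P.pow_modEq.symm.add_right _
      _ = (q ^ i + q * t + j) * q ^ (m - i) := by rw [hm]; ring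

/-- As qt + j < q^i, the value lies in [q^i, 2q^i), which fixes i; its residue mod q then fixes j,
since 1 ≤ j < q. -/
theorem tripleSet_injOn :
    Set.InjOn (fun x : ℕ × ℕ × ℕ => q ^ x.1 + q * x.2.2 + x.2.1) (tripleSet q n r m) := by
  rintro ⟨i, j, t⟩ h ⟨i', j', t'⟩ h' heq
  simp only at heq
  have hq := P.two_le
  have key : ∀ {i j t i' j' t' : ℕ}, (i, j, t) ∈ tripleSet q n r m →
      q ^ i + q * t + j = q ^ i' + q * t' + j' → i' ≤ i := by
    intro i j t i' j' t' h heq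
    have h1 := P.tripleSet_lt h
    by_contra! hlt
    have : q ^ (i + 1) ≤ q ^ i' := Nat.pow_le_pow_right (by omega) hlt
    rw [pow_succ] at this
    have := Nat.mul_le_mul_left (q ^ i) hq
    omega
  obtain rfl : i = i' := le_antisymm (key h' heq.symm) (key h heq)
  obtain ⟨-, -, -, hj, -⟩ := P.tripleSet_spec h
  obtain ⟨-, -, -, hj', -⟩ := P.tripleSet_spec h'
  have h2 : j + q * t = j' + q * t' := by omega
  have hjj : j = j' := by
    have := congrArg (· % q) h2
    simpa [Nat.mod_eq_of_lt hj, Nat.mod_eq_of_lt hj'] using this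
  subst hjj
  have : t = t' := Nat.eq_of_mul_eq_mul_left (by omega : 0 < q) (by omega)
  rw [this]

theorem tripleSet_not_dvd {i j t : ℕ} (h : (i, j, t) ∈ tripleSet q n r m) :
    ¬ q ∣ q ^ i + q * t + j := by
  obtain ⟨hi, -, hj, hjq, -⟩ := P.tripleSet_spec h
  intro hd
  have : q ∣ j := (Nat.dvd_add_right ((dvd_pow_self q (by omega)).add (dvd_mul_right q t))).1 hd
  exact absurd (Nat.le_of_dvd hj this) (by omega)

theorem tripleSet_finite : (tripleSet q n r m).Finite := by
  refine Set.Finite.of_finite_image (Set.Finite.subset (Set.finite_Iio (2 * q ^ m)) ?_)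
    P.tripleSet_injOn
  rintro _ ⟨⟨i, j, t⟩, h, rfl⟩
  have h1 := P.tripleSet_lt h
  obtain ⟨-, him, -⟩ := P.tripleSet_spec h
  have : q ^ i ≤ q ^ m := Nat.pow_le_pow_right (by have := P.two_le; omega) him.le
  simp only [Set.mem_Iio]
  omega

theorem ceilHalfSet_contains {D : ℕ}
    (hD : (D : ℤ) + 1 = ⌈(q : ℚ) * (⌈(numCosets q n r m : ℚ) / 2⌉ : ℚ) / ((q : ℚ) - 1)⌉ +
      bigLambda q n r m) {i : ℕ} (hiD : i < D) (hin : i < n) :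
    1 + i * r ∈ ceilHalfSet q n r := by
  have hq := P.two_le
  have hq1 : (0 : ℚ) < (q : ℚ) - 1 := sub_pos.2 (by exact_mod_cast hq)
  set B : Finset ℕ := P.tripleSet_finite.toFinset.image
    (fun x : ℕ × ℕ × ℕ => q ^ x.1 + q * x.2.2 + x.2.1) with hBdef
  have hBcard : B.card = (tripleSet q n r m).ncard := by
    rw [hBdef, Finset.card_image_of_injOn (by simpa using P.tripleSet_injOn),
      Set.ncard_eq_toFinset_card _ P.tripleSet_finite]
  have hA := Int.ceil_lt_add_one
    ((q : ℚ) * (⌈(numCosets q n r m : ℚ) / 2⌉ : ℚ) / ((q : ℚ) - 1))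
  have hL := Int.ceil_lt_add_one ((q : ℚ) * ((tripleSet q n r m).ncard : ℚ) / ((q : ℚ) - 1))
  refine P.mem_firstCosetsUnion_of_count (D := D) B ?_ ?_ hiD hin fun _ => by
    simp only [ratNatCeil_half]; omega
  · intro x hx
    obtain ⟨⟨i', j, t⟩, h, rfl⟩ := Finset.mem_image.1 hx
    rw [Set.Finite.mem_toFinset] at h
    obtain ⟨-, -, hj, -, -, h6, h7⟩ := P.tripleSet_spec h
    refine ⟨?_, by simp only; omega, h6, P.tripleSet_not_dvd h, P.tripleSet_notMem_leaders h⟩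
    have hW : 1 ≤ (tripleSet q n r m).ncard := (Set.ncard_pos P.tripleSet_finite).2 ⟨_, h⟩
    -- One triple already makes this ceiling at least 2, so D exceeds the factor ⌈⋯⌉ - 2 in the size
    -- condition of S_m.
    have hL1 : 1 < ⌈(q : ℚ) * ((tripleSet q n r m).ncard : ℚ) / ((q : ℚ) - 1)⌉ := by
      rw [Int.lt_ceil, lt_div_iff₀ hq1]
      have : (1 : ℚ) ≤ ((tripleSet q n r m).ncard : ℚ) := by exact_mod_cast hW
      have : (q : ℚ) * 1 ≤ q * ((tripleSet q n r m).ncard : ℚ) :=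
        mul_le_mul_of_nonneg_left this (Nat.cast_nonneg q)
      push_cast
      linarith
    rw [bigLambda] at hD
    have hr := P.r_pos
    have hle : (⌈(q : ℚ) * (⌈(numCosets q n r m : ℚ) / 2⌉ : ℚ) / ((q : ℚ) - 1)⌉ - 2) * (r : ℤ) <
        D * r := mul_lt_mul_of_pos_right (by omega) (by exact_mod_cast hr)
    have : ((q ^ i' + q * t + j : ℕ) : ℤ) < ((1 + D * r : ℕ) : ℤ) := by
      push_cast at h7 ⊢
      linarith
    exact_mod_cast this
  · refine sub_div_le_of_mul_pred_le (by omega) ?_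
    rw [hBcard]
    simp only [ratNatCeil_half]
    rw [bigLambda] at hD
    have hDQ := congrArg (Int.cast : ℤ → ℚ) hD
    rw [ratCeil_half, Int.cast_natCast] at hA hDQ
    push_cast at hDQ
    -- D is the sum of the two ceilings minus 2, and each ceiling exceeds its argument by less than
    -- 1.
    have : (D : ℚ) < (q * ((numCosets q n r m + 1) / 2 : ℕ) + q * (tripleSet q n r m).ncard) /
        ((q : ℚ) - 1) := by
      rw [add_div]
      linarith
    rw [lt_div_iff₀ hq1] at this
    have hcast : ((q - 1 : ℕ) : ℚ) = (q : ℚ) - 1 := by rw [Nat.cast_sub (by omega)]; simp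
    rw [← hcast, ← mul_add] at this
    exact_mod_cast this.le

theorem floorHalfSet_contains (hqr : q * r ≤ 2 * m * (q - 1)) {D : ℕ}
    (hD : ((D : ℤ) + 1) = ⌊(q : ℚ) * (numCosets q n r m : ℚ) / (2 * ((q : ℚ) - 1))⌋)
    {i : ℕ} (hiD : i < D) (hin : i < n) : 1 + i * r ∈ floorHalfSet q n r := by
  have hq := P.two_le
  have hq1 : (0 : ℚ) < (q : ℚ) - 1 := sub_pos.2 (by exact_mod_cast hq)
  have hcast : ((q - 1 : ℕ) : ℚ) = (q : ℚ) - 1 := by rw [Nat.cast_sub (by omega)]; simp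
  have hDN : (D + 1) * (2 * (q - 1)) ≤ q * numCosets q n r m := by
    have h := Int.floor_le ((q : ℚ) * (numCosets q n r m : ℚ) / (2 * ((q : ℚ) - 1)))
    rw [← hD, le_div_iff₀ (by linarith), ← hcast] at h
    exact_mod_cast h
  refine P.mem_firstCosetsUnion_of_count (D := D) ∅ (by simp) ?_ hiD hin fun hdvd => ?_
  · refine sub_div_le_of_mul_pred_le (by omega) ?_
    simp only [ratNatFloor_half, Finset.card_empty, add_zero]
    obtain ⟨c, rfl⟩ := Nat.exists_eq_add_of_le' hq
    -- Halving an odd number loses at most q here, which the spare 2(q-1) ≥ q in `hDN` absorbs.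
    have h1 : numCosets (c + 2) n r m ≤ 2 * (numCosets (c + 2) n r m / 2) + 1 := by omega
    have h2 := Nat.mul_le_mul_left (c + 2) h1
    simp only [show c + 2 - 1 = c + 1 by omega] at hDN ⊢
    nlinarith
  · exfalso
    have hNm := P.numCosets_m_mul
    have hn := P.one_lt_n
    have hm := P.one_lt_m
    have hpos : 0 < 2 * m * (q - 1) := Nat.mul_pos (by omega) (by omega)
    -- This gives (D+1)r ≤ n - 1, hence 1 + ir < n for i < D, against n ∣ 1 + ir.
    have h1 : (2 * m * (q - 1)) * ((D + 1) * r) ≤ (2 * m * (q - 1)) * (n - 1) := by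
      calc (2 * m * (q - 1)) * ((D + 1) * r) = ((D + 1) * (2 * (q - 1))) * (m * r) := by ring
        _ ≤ (q * numCosets q n r m) * (m * r) := Nat.mul_le_mul_right _ hDN
        _ = (q * r) * (n - 1) := by rw [← hNm]; ring
        _ ≤ _ := Nat.mul_le_mul_right _ hqr
    have h2 := Nat.le_of_mul_le_mul_left h1 hpos
    have h3 : (i + 1) * r ≤ (D + 1) * r := Nat.mul_le_mul_right _ (by omega)
    have h4 := Nat.le_of_dvd (by omega) hdvd
    have hr := P.r_pos
    rw [add_mul] at h3
    omega

end CosetParams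

/-! ### The two families of codes -/

/-- A code whose defining set is the union of the first `h N_l` cosets of each size. -/
theorem exists_firstCosets_code {F K : Type*} [Field F] [Fintype F] [Field K] [Algebra F K]
    {q n r m : ℕ} (P : CosetParams q n r m) (hq : Fintype.card F = q) {lam : F}
    (hlam : orderOf lam = r) {β : K} (hβ : IsPrimitiveRoot β (n * r))
    (hβn : β ^ n = algebraMap F K lam) (h : ℕ → ℕ) (hh : ∀ N, h N ≤ N) (d : ℤ)
    (hd : ∀ D : ℕ, (D : ℤ) + 1 = d → ∀ i < D, i < n → 1 + i * r ∈ firstCosetsUnion h q n r) :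
    ∃ g : F[X], g.Monic ∧ g ∣ X ^ n - C lam ∧ IsConstacyclic lam (constacyclicCode n lam g) ∧
      definingSet n r β g = firstCosetsUnion h q n r ∧
      (Module.finrank F (constacyclicCode n lam g) : ℤ) =
        (n : ℤ) - (h 1 + m * h (numCosets q n r m)) ∧
      MinDistGE (constacyclicCode n lam g) d := by
  obtain ⟨g, hmon, hg, hdef, hdeg⟩ := exists_generator P hq hlam hβ hβn
    (P.firstCosetsUnion_subset h) fun x hx y hy hxy => P.firstCosetsUnion_mul hx hy hxy
  refine ⟨g, hmon, hg, isConstacyclic_constacyclicCode hg, hdef, ?_, ?_⟩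
  · have hle := Finset.card_le_card (P.firstCosetsUnion_subset h)
    rw [card_zSet P.r_pos] at hle
    rw [finrank_constacyclicCode (by have := P.one_lt_n; omega) hmon hg, hdeg, Nat.cast_sub hle,
      P.card_firstCosetsUnion h hh]
    push_cast
    rfl
  -- For d ≤ 1 this D is 0 and no zeros are needed.
  · refine minDistGE_of_definingSet (D := (d - 1).toNat) P.r_pos hg hβ ?_ (by omega)
    intro i hi hin
    rw [hdef]
    exact hd _ (by omega) i hi hin

theorem theorem5 {F : Type*} [Field F] [Fintype F] (q r p b n : ℕ)
    (hq : Fintype.card F = q) (hr : r ∣ q - 1) (hp : p.Prime) (hb : 1 ≤ b)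
    (hpq : ¬ p ∣ q - 1)
    (hn : (n : ℤ) = (Polynomial.cyclotomic (p ^ b) ℤ).eval (q : ℤ)) :
    cosetSizes q n r = {1, p ^ b} ∧
    numCosets q n r 1 = 1 ∧
    (numCosets q n r (p ^ b) : ℚ) = ((n : ℚ) - 1) / (p : ℚ) ^ b ∧
    (n : ℤ) < (Polynomial.cyclotomic (p ^ (b + 1)) ℤ).eval (q : ℤ) ∧
    (∃ lam : F, orderOf lam = r) ∧
    ∀ lam : F, orderOf lam = r →
      (∃ β : AlgebraicClosure F, IsPrimitiveRoot β (n * r) ∧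
        β ^ n = algebraMap F (AlgebraicClosure F) lam) ∧
      ∀ β : AlgebraicClosure F, IsPrimitiveRoot β (n * r) →
        β ^ n = algebraMap F (AlgebraicClosure F) lam →
        (∃ g : Polynomial F, g.Monic ∧ g ∣ Polynomial.X ^ n - Polynomial.C lam ∧
          IsConstacyclic lam (constacyclicCode n lam g) ∧
          definingSet n r β g = ceilHalfSet q n r ∧
          (Module.finrank F (constacyclicCode n lam g) : ℤ) =
            (n : ℤ) - 1 - (p : ℤ) ^ b * ⌈((n : ℚ) - 1) / (2 * (p : ℚ) ^ b)⌉ ∧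
          MinDistGE (constacyclicCode n lam g)
            (⌈(q : ℚ) * (⌈((n : ℚ) - 1) / (2 * (p : ℚ) ^ b)⌉ : ℚ) / ((q : ℚ) - 1)⌉ +
              bigLambda q n r (p ^ b))) ∧
        ((r ≤ 3 ∨ q * r ≤ 2 * p ^ b * (q - 1)) →
          ∃ g : Polynomial F, g.Monic ∧ g ∣ Polynomial.X ^ n - Polynomial.C lam ∧
            IsConstacyclic lam (constacyclicCode n lam g) ∧
            definingSet n r β g = floorHalfSet q n r ∧
            (Module.finrank F (constacyclicCode n lam g) : ℤ) =
              (n : ℤ) - (p : ℤ) ^ b * ⌊((n : ℚ) - 1) / (2 * (p : ℚ) ^ b)⌋ ∧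
            MinDistGE (constacyclicCode n lam g)
              ⌊(q : ℚ) * ((n : ℚ) - 1) / (2 * (p : ℚ) ^ b * ((q : ℚ) - 1))⌋) := by
  obtain ⟨b, rfl⟩ := Nat.exists_eq_add_of_le' hb
  have hq2 : 2 ≤ q := hq ▸ Fintype.one_lt_card (α := F)
  rw [cyclotomic_prime_pow_eval p b q hp] at hn
  have hn' : n = ∑ i ∈ Finset.range p, (q ^ p ^ b) ^ i := by exact_mod_cast hn
  have P : CosetParams q n r (p ^ (b + 1)) := hn' ▸ cosetParams_geom_sum hq2 hp hpq hr
  have hm0 : (p : ℚ) ^ (b + 1) ≠ 0 := pow_ne_zero _ (by exact_mod_cast hp.ne_zero)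
  have hq1 : (q : ℚ) - 1 ≠ 0 := sub_ne_zero.2 (by exact_mod_cast (by omega : q ≠ 1))
  have hN : (numCosets q n r (p ^ (b + 1)) : ℚ) = ((n : ℚ) - 1) / (p : ℚ) ^ (b + 1) := by
    rw [eq_div_iff hm0]
    have := congrArg (Nat.cast : ℕ → ℚ) P.numCosets_m_mul
    rw [Nat.cast_sub (by have := P.one_lt_n; omega)] at this
    exact_mod_cast this
  have hhalf : ((n : ℚ) - 1) / (2 * (p : ℚ) ^ (b + 1)) =
      (numCosets q n r (p ^ (b + 1)) : ℚ) / 2 := by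
    rw [hN]; field_simp
  have hbound : (q : ℚ) * ((n : ℚ) - 1) / (2 * (p : ℚ) ^ (b + 1) * ((q : ℚ) - 1)) =
      (q : ℚ) * (numCosets q n r (p ^ (b + 1)) : ℚ) / (2 * ((q : ℚ) - 1)) := by
    rw [hN]; field_simp
  refine ⟨P.cosetSizes_eq, P.numCosets_one, hN, ?_, exists_orderOf_eq hq hr hq2, ?_⟩
  · rw [cyclotomic_prime_pow_eval p (b + 1) q hp, hn', Nat.cast_lt]
    have hlt : q ^ p ^ b < q ^ p ^ (b + 1) :=
      Nat.pow_lt_pow_right (by omega) (Nat.pow_lt_pow_right hp.one_lt (by omega))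
    exact Finset.sum_lt_sum (fun i _ => Nat.pow_le_pow_left hlt.le i)
      ⟨1, Finset.mem_range.2 hp.one_lt, by simpa using hlt⟩
  · intro lam hlam
    refine ⟨exists_primitiveRoot_pow_eq P hq hlam, fun β hβ hβn => ⟨?_, fun hrq => ?_⟩⟩
    · obtain ⟨g, hmon, hg, hcyc, hdef, hdim, hdist⟩ := exists_firstCosets_code P hq hlam hβ hβn
        (fun N => ⌈(N : ℚ) / 2⌉₊) (fun N => by simp only [ratNatCeil_half]; omega) _
        fun D hD i hi hin => P.ceilHalfSet_contains hD hi hin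
      rw [hhalf]
      refine ⟨g, hmon, hg, hcyc, hdef, ?_, hdist⟩
      simp only [ratNatCeil_half] at hdim
      rw [hdim, ratCeil_half]
      push_cast
      ring
    · have hqr : q * r ≤ 2 * p ^ (b + 1) * (q - 1) := by
        rcases hrq with h3 | h
        · have hrle := Nat.le_of_dvd (by omega) hr
          have hm := P.one_lt_m
          -- m ≥ 2; the case r = 3 needs q ≥ 4, which follows from r ≤ q - 1.
          calc q * r ≤ 2 * 2 * (q - 1) := by interval_cases r <;> omega
            _ ≤ _ := Nat.mul_le_mul_right _ (Nat.mul_le_mul_left _ hm)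
        · exact h
      obtain ⟨g, hmon, hg, hcyc, hdef, hdim, hdist⟩ := exists_firstCosets_code P hq hlam hβ hβn
        (fun N => ⌊(N : ℚ) / 2⌋₊) (fun N => by simp only [ratNatFloor_half]; omega) _
        fun D hD i hi hin => P.floorHalfSet_contains hqr hD hi hin
      rw [hhalf, hbound]
      refine ⟨g, hmon, hg, hcyc, hdef, ?_, hdist⟩
      simp only [ratNatFloor_half] at hdim
      rw [hdim, ratFloor_half]
      push_cast
      ring
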